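/- **Setting.** An instance $I=(k,T,n,q,r)$ of the sequential offering problem consists of integers $1\le k\le T\le n$, probabilities $q_i\in[0,1]$ and values $r_i\ge 0$ for $i\in[n]$. Offers are sent one at a time, at most $T$ in total and at most one to each candidate; candidate $i$ accepts with probability $q_i$, independently of the others, and is then worth $r_i$. At most $k$ candidates can be hired, and a candidate who accepts must be hired. Let $$\mathrm{LP}_{\mathrm{seq}}(I)=\max\Big\{\sum_i r_iy_iq_i:\ \sum_i y_i\le T,\ \sum_i y_iq_i\le k,\ 0\le y_i\le 1\ \forall i\Big\},$$ and let $\mathrm{LP}_{\mathrm{ptk}}(I)$ be the linear program: maximize $\sum_i r_ix_i$ subject to $0\le x_i\le y_iq_i$ and $0\le y_i\le 1$ for all $i$, $\sum_i y_i\le T$, $\sum_i x_i\le k$. **Algorithm.** Given a feasible solution $(x,y)$ of $\mathrm{LP}_{\mathrm{ptk}}(I)$ such that $y$ has at most two non-integer components, which add up to $1$ if there are exactly two, the algorithm does the following. It selects every $i$ with $y_i=1$ and no $i$ with $y_i=0$; if there is one non-integer component $i_1$, it selects $i_1$ with probability $y_{i_1}$; if there are two, $i_1$ and $i_2$, it selects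 exactly one of them, $i_1$ with probability $y_{i_1}$ and $i_2$ with probability $y_{i_2}=1-y_{i_1}$. Then, as long as fewer than $T$ offers were made and fewer than $k$ candidates hired, it makes offers to the selected candidates in decreasing order of $v_i=r_ix_i/x_i$ ($v_i=0$ if $x_i=0$), ties broken arbitrarily, and hires a candidate $i$ who accepts with probability $x_i/(y_iq_i)$. $\mathrm{ALG}_{\mathrm{seq}}$ is this algorithm for an optimal solution $(x,y)$ of $\mathrm{LP}_{\mathrm{ptk}}(I)$ with $x_i=y_iq_i$ for all $i$. **Corollary 1.** Let $I$ be an instance of the sequential offering problem with $k$ positions. 1. $\mathrm{LP}_{\mathrm{ptk}}(I)$ has an optimal basic feasible solution with $x_i=y_iq_i$ for all $i$; and in every basic feasible solution, $y$ has at most two non-integer components, which add up to $1$ if there are exactly two. 2. For every optimal solution $(x,y)$ with $x_i=y_iq_i$ for all $i$, in which $y$ has at most two non-integer components, adding up to $1$ if there are exactly two, and for every way to break ties, $\mathrm{ALG}_{\mathrm{seq}}$ is admissible for the sequential offering problem (with probability one it makes at most $T$ offers, hires at most $k$ candidates and hires every candidate who accepts), and its expected reward, the expected total value of the hired candidates,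 satisfies $$R_{\mathrm{ALG}_{\mathrm{seq}}}(I)\ \ge\ \Big(1-\frac{e^{-k}k^k}{k!}\Big)\,\mathrm{LP}_{\mathrm{seq}}(I).$$ -/

import Mathlib

open scoped Nat

noncomputable section

/-- An instance of the sequential offering problem: `n` candidates, `k` positions, at most `T`
offers; candidate `i` accepts an offer with probability `q i`, independently of the others, and is
then worth `r i`. Equivalently, the weighted Bernoulli instance of ProbeTop-`k` in which `V i = r i`
with probability `q i` and `V i = 0` otherwise. -/
structure SeqInstance where
  n : ℕ
  k : ℕ
  T : ℕ
  q : Fin n → ℝ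
  r : Fin n → ℝ
  one_le_k : 1 ≤ k
  k_le_T : k ≤ T
  T_le_n : T ≤ n
  q_nonneg : ∀ i, 0 ≤ q i
  q_le_one : ∀ i, q i ≤ 1
  r_nonneg : ∀ i, 0 ≤ r i

namespace SeqInstance

variable (I : SeqInstance)

/-- Feasible region of the linear program `LP_seq`. -/
def seqFeasible : Set (Fin I.n → ℝ) :=
  {y | ∑ i, y i ≤ I.T ∧ ∑ i, y i * I.q i ≤ I.k ∧ ∀ i, 0 ≤ y i ∧ y i ≤ 1}

/-- The optimal value of `LP_seq`. The feasible region contains `0` and is compact, so the supremum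
is a maximum. -/
def LPseq : ℝ :=
  sSup ((fun y : Fin I.n → ℝ => ∑ i, I.r i * y i * I.q i) '' I.seqFeasible)

/-- Feasible region of `LP_ptk` for weighted Bernoulli values. A solution is a pair `s = (x, y)`:
`y i` stands for the probability that `i` is interviewed, `x i` for the probability that `i` is
hired with value `r i`. -/
def ptkFeasible : Set ((Fin I.n → ℝ) × (Fin I.n → ℝ)) :=
  {s | (∀ i, s.1 i ≤ s.2 i * I.q i) ∧ ∑ i, s.2 i ≤ I.T ∧ ∑ i, s.1 i ≤ I.k ∧
    (∀ i, 0 ≤ s.1 i) ∧ ∀ i, 0 ≤ s.2 i ∧ s.2 i ≤ 1}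

/-- Objective of `LP_ptk` for weighted Bernoulli values. -/
def ptkObjective (s : (Fin I.n → ℝ) × (Fin I.n → ℝ)) : ℝ := ∑ i, I.r i * s.1 i

/-- Optimal solutions of `LP_ptk`. -/
def IsPtkOptimal (s : (Fin I.n → ℝ) × (Fin I.n → ℝ)) : Prop :=
  s ∈ I.ptkFeasible ∧ IsMaxOn I.ptkObjective I.ptkFeasible s

/-- Basic feasible solutions (vertices) of `LP_ptk`. -/
def IsPtkBasic (s : (Fin I.n → ℝ) × (Fin I.n → ℝ)) : Prop :=
  s ∈ Set.extremePoints ℝ I.ptkFeasible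

/-- The solutions with `x i = y i * q i`. -/
def IsTight (s : (Fin I.n → ℝ) × (Fin I.n → ℝ)) : Prop := ∀ i, s.1 i = s.2 i * I.q i

end SeqInstance

/-- A coin that shows `true` with probability `p` (for `p` in `[0, 1]`, the only case in use; other
values are replaced by the nearest point of `[0, 1]`). -/
def coin (p : ℝ) : PMF Bool :=
  PMF.ofFintype
    (fun b => ENNReal.ofReal (if b then max 0 (min 1 p) else 1 - max 0 (min 1 p))) <| by
      have h0 : (0 : ℝ) ≤ max 0 (min 1 p) := le_max_left _ _
      have h1 : max 0 (min 1 p) ≤ (1 : ℝ) := max_le zero_le_one (min_le_left _ _)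
      rw [Fintype.sum_bool, ← ENNReal.ofReal_add (by simp)
        (by simp)]
      simp

/-- The non-integer components of a vector in `[0, 1]ⁿ`. -/
def fractional {n : ℕ} (y : Fin n → ℝ) : Finset (Fin n) :=
  Finset.univ.filter fun i => 0 < y i ∧ y i < 1

/-- The vectors that dependent rounding accepts: at most two non-integer components, and if there
are two, then they add up to `1`. -/
def Roundable {n : ℕ} (y : Fin n → ℝ) : Prop :=
  (fractional y).card ≤ 2 ∧ ((fractional y).card = 2 → ∑ i ∈ fractional y, y i = 1)

/-- Dependent rounding of a `Roundable` vector `y`: the law of the random set `{i | Y i = 1}`. The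
components with `y i = 1` are always selected and those with `y i = 0` never; a single fractional
component `i₁` is selected with probability `y i₁`; of two fractional components `i₁`, `i₂`, exactly
one is selected, `i₁` with probability `y i₁` and `i₂` with probability `1 - y i₁ = y i₂`. -/
def dependentRounding {n : ℕ} (y : Fin n → ℝ) : PMF (Finset (Fin n)) :=
  let S : Finset (Fin n) := Finset.univ.filter fun i => y i = 1
  if h : (fractional y).Nonempty then
    let i₁ := (fractional y).min' h
    let i₂ := (fractional y).max' h
    if (fractional y).card = 1 then
      (coin (y i₁)).map fun b => if b then insert i₁ S else S
    else
      (coin (y i₁)).map fun b => if b then insert i₁ S else insert i₂ S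
  else PMF.pure S

/-- What has happened so far in a run: the candidates that were sent an offer (were interviewed),
those among them that accepted (had value `r i`), and those among them that were hired. -/
structure Outcome (n : ℕ) where
  offered : Finset (Fin n)
  accepted : Finset (Fin n)
  hired : Finset (Fin n)

namespace SeqInstance

variable (I : SeqInstance)

/-- `v i = r i * x i / x i`, which is `0` if `x i = 0`: the expected value of `i` given that she is
hired. -/
def value (s : (Fin I.n → ℝ) × (Fin I.n → ℝ)) (i : Fin I.n) : ℝ := I.r i * s.1 i / s.1 i

/-- The probability with which the algorithm hires `i` when her value turns out to be `r i`. -/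
def hireProb (s : (Fin I.n → ℝ) × (Fin I.n → ℝ)) (i : Fin I.n) : ℝ := s.1 i / (s.2 i * I.q i)

/-- Process the candidates of a list one by one, starting from the state `o`. As long as fewer than
`T` offers were made and fewer than `k` candidates hired, make an offer to the next candidate `i`,
who accepts with probability `q i`; upon acceptance hire her with probability `h i`. -/
def run (h : Fin I.n → ℝ) : List (Fin I.n) → Outcome I.n → PMF (Outcome I.n)
  | [], o => PMF.pure o
  | i :: L, o =>
    if o.offered.card < I.T ∧ o.hired.card < I.k then
      (coin (I.q i)).bind fun a => (coin (h i)).bind fun b =>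
        run h L
          { offered := insert i o.offered
            accepted := if a then insert i o.accepted else o.accepted
            hired := if a && b then insert i o.hired else o.hired }
    else PMF.pure o

/-- The algorithm, run with the LP solution `s = (x, y)` and with the candidates labelled as
`σ 0, σ 1, …`: round `y`, and then process the selected candidates in the order of their labels.
`ALG_seq` is this algorithm for an optimal `s` with `x i = y i * q i` and a labelling in decreasing
order of `value s`. -/
def alg (s : (Fin I.n → ℝ) × (Fin I.n → ℝ)) (σ : Equiv.Perm (Fin I.n)) : PMF (Outcome I.n) :=
  (dependentRounding s.2).bind fun S =>
    I.run (I.hireProb s) (((List.finRange I.n).map σ).filter fun i => i ∈ S) ⟨∅, ∅, ∅⟩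

/-- The expected total value of the hired candidates. -/
def expectedReward (p : PMF (Outcome I.n)) : ℝ :=
  ∑ H : Finset (Fin I.n), ((p.map Outcome.hired) H).toReal * ∑ i ∈ H, I.r i

/-- With probability one, at most `T` offers are made, at most `k` candidates are hired, and the
hired candidates are exactly those who accepted: no acceptance is ever refused. -/
def IsAdmissible (p : PMF (Outcome I.n)) : Prop :=
  ∀ o ∈ p.support, o.offered.card ≤ I.T ∧ o.hired.card ≤ I.k ∧ o.hired = o.accepted

end SeqInstance

end

/-! Fix the order of decreasing value and a prefix of it. The selected candidates of the prefix are
processed first and number at most `T`, so the offers cannot run out among them. By tightness every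
acceptance is a hire, so the hires from the prefix are min(k, N), with N the number of candidates of
the prefix who would accept if all its selected ones got an offer. Rounding selects at most one
fractional candidate, so N is a sum of independent Bernoulli variables, one of them a mixture, and
its mean is the LP mass ∑ x of the prefix, at most k.

Now E min(k, N) = k - E(k - N)⁺. Since the Poisson shortfall is convex in its mean, it lies above
its tangents, which makes it dominate the Bernoulli shortfall of the same mean
(`shortfall_le_poissonShortfall`), and below its chord over [0, k], which gives the factor γ = 1 -
e^{-k}k^k/k! (`le_sub_shortfall`). Hence every prefix receives at least γ times its LP mass in
expected hires (`le_expect_alg_prefix`), and summation by parts against the decreasing values turns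
this into the bound on the reward.

For the LP, the tight optimal solutions form a compact face, which contains a vertex. At a vertex no
nonzero perturbation of the fractional components may preserve ∑ x and ∑ y; counting equations
leaves at most two such components, and with two the offer budget is exhausted, so integrality of
`T` makes them add up to 1. -/

/-! ### Poisson and Bernoulli shortfalls -/

/-- `P(N < c)` for a Poisson variable `N` of mean `m`. -/
noncomputable def poissonLt (c : ℕ) (m : ℝ) : ℝ :=
  Real.exp (-m) * ∑ i ∈ Finset.range c, m ^ i / (i ! : ℝ)

/-- `E (c - N)⁺` for a Poisson variable `N` of mean `m`, as the sum of `P(N ≤ j)` over `j < c`. -/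
noncomputable def poissonShortfall (c : ℕ) (m : ℝ) : ℝ :=
  ∑ j ∈ Finset.range c, poissonLt (j + 1) m

/-- `E (c - N)⁺` for a sum `N` of independent Bernoulli variables with the listed parameters. -/
noncomputable def shortfall : ℕ → List ℝ → ℝ
  | c, [] => c
  | c, a :: l => (1 - a) * shortfall c l + a * shortfall (c - 1) l

theorem poissonLt_zero (m : ℝ) : poissonLt 0 m = 0 := by simp [poissonLt]

theorem poissonLt_succ (c : ℕ) (m : ℝ) :
    poissonLt (c + 1) m = poissonLt c m + Real.exp (-m) * (m ^ c / (c ! : ℝ)) := by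
  simp [poissonLt, Finset.sum_range_succ, mul_add]

theorem poissonShortfall_succ (c : ℕ) (m : ℝ) :
    poissonShortfall (c + 1) m = poissonShortfall c m + poissonLt (c + 1) m := by
  simp [poissonShortfall, Finset.sum_range_succ]

/-- The derivative of a Poisson weight in the mean is the difference of two consecutive weights, so
the sum telescopes. -/
theorem hasDerivAt_poissonLt_succ (c : ℕ) (m : ℝ) :
    HasDerivAt (poissonLt (c + 1)) (-(Real.exp (-m) * (m ^ c / (c ! : ℝ)))) m := by
  have hexp : HasDerivAt (fun m : ℝ => Real.exp (-m)) (-Real.exp (-m)) m := by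
    simpa using (hasDerivAt_neg m).exp
  induction c with
  | zero =>
    have : poissonLt (0 + 1) = fun m => Real.exp (-m) := by
      funext x; simp [poissonLt]
    rw [this]
    simpa using hexp
  | succ c ih =>
    have : poissonLt (c + 1 + 1) = fun m => poissonLt (c + 1) m
        + Real.exp (-m) * (m ^ (c + 1) / ((c + 1)! : ℝ)) := by
      funext x; exact poissonLt_succ _ _
    rw [this]
    have hp : HasDerivAt (fun m : ℝ => m ^ (c + 1) / ((c + 1)! : ℝ)) (m ^ c / (c ! : ℝ)) m := by
      refine ((hasDerivAt_pow (c + 1) m).div_const ((c + 1)! : ℝ)).congr_deriv ?_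
      have h1 : (c ! : ℝ) ≠ 0 := by positivity
      have h2 : (c + 1 : ℝ) ≠ 0 := by positivity
      rw [Nat.factorial_succ]
      push_cast
      field_simp
    refine (ih.add (hexp.mul hp)).congr_deriv ?_
    ring

theorem hasDerivAt_poissonShortfall (c : ℕ) (m : ℝ) :
    HasDerivAt (poissonShortfall c) (-poissonLt c m) m := by
  induction c with
  | zero =>
    have : poissonShortfall 0 = fun _ => 0 := by funext x; simp [poissonShortfall]
    rw [this, poissonLt_zero, neg_zero]
    exact hasDerivAt_const _ _
  | succ c ih =>
    have : poissonShortfall (c + 1) = fun m => poissonShortfall c m + poissonLt (c + 1) m := by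
      funext x; exact poissonShortfall_succ _ _
    rw [this]
    refine (ih.add (hasDerivAt_poissonLt_succ c m)).congr_deriv ?_
    rw [poissonLt_succ]
    ring

/-- The second derivative is a Poisson weight. -/
theorem convexOn_poissonShortfall (c : ℕ) :
    ConvexOn ℝ (Set.Ici 0) (poissonShortfall c) := by
  cases c with
  | zero =>
    have : poissonShortfall 0 = fun _ => 0 := by funext x; simp [poissonShortfall]
    rw [this]
    exact convexOn_const 0 (convex_Ici 0)
  | succ c =>
    refine convexOn_of_hasDerivWithinAt2_nonneg (convex_Ici 0)
      (f' := fun m => -poissonLt (c + 1) m)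
      (f'' := fun m => Real.exp (-m) * (m ^ c / (c ! : ℝ)))
      (fun x _ => (hasDerivAt_poissonShortfall _ x).continuousAt.continuousWithinAt)
      (fun x _ => (hasDerivAt_poissonShortfall _ x).hasDerivWithinAt)
      (fun x _ => ?_) (fun x hx => ?_)
    · have := (hasDerivAt_poissonLt_succ c x).neg
      rw [neg_neg] at this
      exact this.hasDerivWithinAt
    · have : 0 ≤ x := le_of_lt (by simpa using hx)
      positivity

theorem poissonShortfall_tangent (c : ℕ) {m p : ℝ} (hm : 0 ≤ m) (hp : 0 ≤ p) :
    poissonShortfall c m - p * poissonLt c m ≤ poissonShortfall c (m + p) := by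
  rcases hp.eq_or_lt with rfl | hp
  · simp
  have h := (convexOn_poissonShortfall c).le_slope_of_hasDerivAt (x := m) (y := m + p)
    hm (by simp only [Set.mem_Ici]; linarith) (by linarith) (hasDerivAt_poissonShortfall c m)
  rw [slope_def_field, le_div_iff₀ (by linarith)] at h
  linarith

/-- At capacity 0 the truncated `c - 1` is again 0, which is what the positive part requires. -/
theorem shortfall_zero (l : List ℝ) : shortfall 0 l = 0 := by
  induction l with
  | nil => simp [shortfall]
  | cons a l ih => simp [shortfall, ih]

theorem shortfall_zero_cons (c : ℕ) (l : List ℝ) : shortfall c (0 :: l) = shortfall c l := by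
  simp [shortfall]

/-- The shortfall is affine in each parameter: a random choice between two Bernoulli variables is
one Bernoulli variable of averaged parameter. -/
theorem shortfall_mix (c : ℕ) (t a b : ℝ) (l : List ℝ) :
    t * shortfall c (a :: l) + (1 - t) * shortfall c (b :: l)
      = shortfall c ((t * a + (1 - t) * b) :: l) := by
  simp only [shortfall]
  ring

theorem shortfall_perm {l₁ l₂ : List ℝ} (h : l₁.Perm l₂) (c : ℕ) :
    shortfall c l₁ = shortfall c l₂ := by
  induction h generalizing c with
  | nil => rfl
  | cons a _ ih => simp only [shortfall, ih]
  | swap a b l => simp only [shortfall]; ring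
  | trans _ _ ih₁ ih₂ => rw [ih₁, ih₂]

theorem poissonShortfall_mean_zero (c : ℕ) : poissonShortfall c 0 = c := by
  have h : ∀ j, poissonLt (j + 1) 0 = 1 := fun j => by
    simp [poissonLt, Finset.sum_range_succ']
  simp [poissonShortfall, h]

/-- The Bernoulli variables are replaced by Poisson ones one at a time. Adding a Bernoulli variable
of parameter a to a Poisson variable of mean m lowers the shortfall by a·P(N < c), which is exactly
the tangent at m followed to m + a. -/
theorem shortfall_le_poissonShortfall (l : List ℝ) (hl : ∀ a ∈ l, 0 ≤ a ∧ a ≤ 1) (c : ℕ) :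
    shortfall c l ≤ poissonShortfall c l.sum := by
  induction l generalizing c with
  | nil => simp [shortfall, poissonShortfall_mean_zero]
  | cons a l ih =>
    have ih := ih fun b hb => hl b (List.mem_cons_of_mem _ hb)
    obtain ⟨h0, h1⟩ := hl a List.mem_cons_self
    cases c with
    | zero => simp [shortfall_zero, poissonShortfall]
    | succ c =>
      have hs : 0 ≤ l.sum := List.sum_nonneg fun b hb => (hl b (List.mem_cons_of_mem _ hb)).1
      have ht := poissonShortfall_tangent (c + 1) hs h0
      have e := poissonShortfall_succ c l.sum
      simp only [shortfall, List.sum_cons, Nat.add_sub_cancel]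
      rw [add_comm a]
      calc (1 - a) * shortfall (c + 1) l + a * shortfall c l
          ≤ (1 - a) * poissonShortfall (c + 1) l.sum + a * poissonShortfall c l.sum :=
            add_le_add (mul_le_mul_of_nonneg_left (ih _) (by linarith))
              (mul_le_mul_of_nonneg_left (ih _) h0)
        _ = poissonShortfall (c + 1) l.sum - a * poissonLt (c + 1) l.sum := by rw [e]; ring
        _ ≤ _ := ht

/-- Used at m = c, where the first term vanishes and the constant of the theorem remains. -/
theorem poissonShortfall_eq (c : ℕ) (m : ℝ) :
    poissonShortfall c m
      = (c - m) * poissonLt c m + c * (Real.exp (-m) * (m ^ c / (c ! : ℝ))) := by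
  induction c with
  | zero => simp [poissonShortfall, poissonLt]
  | succ c ih =>
    rw [poissonShortfall_succ, ih, poissonLt_succ, Nat.factorial_succ]
    have h1 : (c ! : ℝ) ≠ 0 := by positivity
    have h2 : (c + 1 : ℝ) ≠ 0 := by positivity
    push_cast
    field_simp
    ring

/-- The truncated mean of a sum of independent Bernoulli variables of total mean at most `k`. -/
theorem le_sub_shortfall {k : ℕ} (hk : 1 ≤ k) (l : List ℝ) (hl : ∀ a ∈ l, 0 ≤ a ∧ a ≤ 1)
    (hs : l.sum ≤ k) :
    (1 - Real.exp (-(k : ℝ)) * (k : ℝ) ^ k / (k ! : ℝ)) * l.sum ≤ k - shortfall k l := by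
  have h0 : 0 ≤ l.sum := List.sum_nonneg fun b hb => (hl b hb).1
  have hk' : (0 : ℝ) < k := by exact_mod_cast hk
  have h1 : 0 ≤ 1 - l.sum / (k : ℝ) := by rw [sub_nonneg, div_le_one hk']; exact hs
  -- Chord over [0, k]: the mean is a combination of the endpoints with weight mean/k on k. The
  -- shortfall is k at 0 and k·e^{-k}k^k/k! at k.
  have hc := (convexOn_poissonShortfall k).2 (Set.mem_Ici.2 le_rfl) (Set.mem_Ici.2 hk'.le)
    h1 (by positivity : 0 ≤ l.sum / (k : ℝ)) (by ring)
  have he : (1 - l.sum / k) • (0 : ℝ) + (l.sum / k) • (k : ℝ) = l.sum := by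
    simp only [smul_eq_mul]; field_simp; ring
  rw [he, poissonShortfall_mean_zero, poissonShortfall_eq k (k : ℝ)] at hc
  have hb := shortfall_le_poissonShortfall l hl k
  have e2 : (1 - l.sum / k) • (k : ℝ) + (l.sum / k) • ((k - k : ℝ) * poissonLt k k
      + k * (Real.exp (-(k : ℝ)) * ((k : ℝ) ^ k / (k ! : ℝ))))
      = k - (1 - Real.exp (-(k : ℝ)) * (k : ℝ) ^ k / (k ! : ℝ)) * l.sum := by
    simp only [smul_eq_mul]; field_simp; ring
  rw [e2] at hc
  linarith

/-- k^k/k! is a single term of the series of e^k. -/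
theorem one_sub_exp_mul_pow_div_factorial_nonneg (k : ℕ) :
    0 ≤ 1 - Real.exp (-(k : ℝ)) * (k : ℝ) ^ k / (k ! : ℝ) := by
  have h := Real.pow_div_factorial_le_exp (k : ℝ) (Nat.cast_nonneg k) k
  have h2 : Real.exp (-(k : ℝ)) * Real.exp k = 1 := by rw [← Real.exp_add]; simp
  have h3 := mul_le_mul_of_nonneg_left h (Real.exp_pos (-(k : ℝ))).le
  rw [h2, ← mul_div_assoc] at h3
  linarith

/-! ### Summation by parts and finite expectations -/

/-- Summation by parts: nonnegative partial sums of `f` against a decreasing nonnegative `v`. -/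
theorem List.sum_map_mul_nonneg_of_prefix {α : Type*} (f v : α → ℝ) (hv : ∀ i, 0 ≤ v i)
    (L : List α) (hL : L.Pairwise fun i j => v j ≤ v i)
    (hf : ∀ L₁ L₂, L = L₁ ++ L₂ → 0 ≤ (L₁.map f).sum) :
    0 ≤ (L.map fun i => f i * v i).sum := by
  -- Generalized for the induction: c is the partial sum of `f` carried over from the terms already
  -- passed, and M bounds the remaining values. As c ≥ 0, lowering M to the next value only
  -- decreases c·M.
  suffices H : ∀ (L : List α) (c M : ℝ), 0 ≤ M → (∀ i ∈ L, v i ≤ M) →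
      L.Pairwise (fun i j => v j ≤ v i) →
      (∀ L₁ L₂, L = L₁ ++ L₂ → 0 ≤ c + (L₁.map f).sum) →
      0 ≤ c * M + (L.map fun i => f i * v i).sum by
    cases L with
    | nil => simp
    | cons i L =>
      have := H (i :: L) 0 (v i) (hv i) (fun j hj => ?_) hL (by simpa using hf)
      · simpa using this
      · rcases List.mem_cons.1 hj with rfl | hj
        · exact le_rfl
        · exact (List.pairwise_cons.1 hL).1 j hj
  intro L
  induction L with
  | nil =>
    intro c M hM _ _ h
    have := h [] [] rfl
    simp only [List.map_nil, List.sum_nil, add_zero] at this ⊢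
    exact mul_nonneg this hM
  | cons i L ih =>
    intro c M hM hle hs h
    obtain ⟨h1, h2⟩ := List.pairwise_cons.1 hs
    have hc : 0 ≤ c := by simpa using h [] (i :: L) rfl
    have := ih (c + f i) (v i) (hv i) h1 h2 fun L₁ L₂ e => by
      simpa [add_assoc] using h (i :: L₁) L₂ (by rw [e]; rfl)
    have hm := mul_le_mul_of_nonneg_left (hle i List.mem_cons_self) hc
    simp only [List.map_cons, List.sum_cons]
    linarith

theorem coin_apply {p : ℝ} (h0 : 0 ≤ p) (h1 : p ≤ 1) (b : Bool) :
    (coin p b).toReal = if b then p else 1 - p := by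
  cases b <;> simp [coin, h0, h1]

theorem pos_of_true_mem_support_coin {p : ℝ} (h : true ∈ (coin p).support) : 0 < p := by
  by_contra! hp
  rw [PMF.mem_support_iff] at h
  exact h (by simp [coin, hp])

theorem false_notMem_support_coin_one : false ∉ (coin 1).support := by
  simp [coin]

/-- The expectation of a real function on a finite type. -/
noncomputable def PMF.expect {α : Type*} [Fintype α] (p : PMF α) (f : α → ℝ) : ℝ :=
  ∑ a, (p a).toReal * f a

theorem PMF.sum_toReal {α : Type*} [Fintype α] (p : PMF α) : ∑ a, (p a).toReal = 1 := by
  rw [← ENNReal.toReal_sum fun a _ => p.apply_ne_top a, ← tsum_fintype (L := .unconditional α),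
    p.tsum_coe, ENNReal.toReal_one]

theorem PMF.expect_bind {α β : Type*} [Fintype α] [Fintype β] (p : PMF α) (g : α → PMF β)
    (f : β → ℝ) : (p.bind g).expect f = p.expect fun a => (g a).expect f := by
  simp only [PMF.expect, PMF.bind_apply, tsum_fintype]
  simp_rw [ENNReal.toReal_sum fun a _ => ENNReal.mul_ne_top (p.apply_ne_top a)
    ((g a).apply_ne_top _), ENNReal.toReal_mul, Finset.sum_mul, Finset.mul_sum]
  rw [Finset.sum_comm]
  simp only [mul_assoc]

theorem PMF.expect_coin {p : ℝ} (h0 : 0 ≤ p) (h1 : p ≤ 1) (f : Bool → ℝ) :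
    (coin p).expect f = p * f true + (1 - p) * f false := by
  simp [PMF.expect, coin_apply h0 h1]

theorem PMF.expect_pure {α : Type*} [Fintype α] (a : α) (f : α → ℝ) :
    (PMF.pure a).expect f = f a := by
  classical
  simp only [PMF.expect, PMF.pure_apply]
  rw [Finset.sum_eq_single a] <;> simp +contextual

theorem PMF.le_expect {α : Type*} [Fintype α] (p : PMF α) (f : α → ℝ) (c : ℝ)
    (h : ∀ a ∈ p.support, c ≤ f a) : c ≤ p.expect f := by
  calc c = ∑ a, (p a).toReal * c := by rw [← Finset.sum_mul, p.sum_toReal, one_mul]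
    _ ≤ _ := Finset.sum_le_sum fun a _ => by
      by_cases ha : p a = 0
      · simp [ha]
      · exact mul_le_mul_of_nonneg_left (h a ((p.mem_support_iff a).2 ha)) ENNReal.toReal_nonneg

theorem PMF.expect_sum {α ι : Type*} [Fintype α] (p : PMF α) (s : Finset ι) (f : ι → α → ℝ) :
    (p.expect fun a => ∑ i ∈ s, f i a) = ∑ i ∈ s, p.expect (f i) := by
  simp only [PMF.expect, Finset.mul_sum]
  exact Finset.sum_comm

theorem PMF.expect_mul_left {α : Type*} [Fintype α] (p : PMF α) (c : ℝ) (f : α → ℝ) :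
    (p.expect fun a => c * f a) = c * p.expect f := by
  simp only [PMF.expect, Finset.mul_sum]
  exact Finset.sum_congr rfl fun _ _ => by ring

theorem PMF.expect_nonneg {α : Type*} [Fintype α] (p : PMF α) (f : α → ℝ) (h : ∀ a, 0 ≤ f a) :
    0 ≤ p.expect f :=
  p.le_expect f 0 fun a _ => h a

/-! ### Dependent rounding -/

theorem dependentRounding_cases {n : ℕ} (y : Fin n → ℝ) (hy : Roundable y) :
    (fractional y = ∅ ∧ dependentRounding y = PMF.pure (Finset.univ.filter fun i => y i = 1)) ∨
    (∃ i, fractional y = {i} ∧ dependentRounding y = (coin (y i)).map fun b =>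
      if b then insert i (Finset.univ.filter fun i => y i = 1)
      else Finset.univ.filter fun i => y i = 1) ∨
    ∃ i j, i ≠ j ∧ fractional y = {i, j} ∧ y i + y j = 1 ∧
      dependentRounding y = (coin (y i)).map fun b =>
        if b then insert i (Finset.univ.filter fun i => y i = 1)
        else insert j (Finset.univ.filter fun i => y i = 1) := by
  obtain ⟨h2, hsum⟩ := hy
  rcases (fractional y).eq_empty_or_nonempty with h | h
  · left
    refine ⟨h, ?_⟩
    simp only [dependentRounding]
    rw [dif_neg (by simp [h])]
  right
  by_cases h1 : (fractional y).card = 1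
  · left
    obtain ⟨i, hi⟩ := Finset.card_eq_one.1 h1
    refine ⟨i, hi, ?_⟩
    simp only [dependentRounding]
    rw [dif_pos h, if_pos h1]
    simp only [hi, Finset.min'_singleton]
  · right
    have hc : (fractional y).card = 2 := by
      have := h.card_pos
      omega
    have hlt : (fractional y).min' h < (fractional y).max' h :=
      Finset.min'_lt_max'_of_card _ (by omega)
    have he : fractional y = {(fractional y).min' h, (fractional y).max' h} := by
      symm
      apply Finset.eq_of_subset_of_card_le
      · intro a ha
        rcases Finset.mem_insert.1 ha with rfl | ha
        · exact Finset.min'_mem _ _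
        · rw [Finset.mem_singleton.1 ha]; exact Finset.max'_mem _ _
      · rw [Finset.card_pair hlt.ne, hc]
    refine ⟨_, _, hlt.ne, he, ?_, ?_⟩
    · rw [← hsum hc]
      conv_rhs => rw [he]
      rw [Finset.sum_pair hlt.ne]
    · simp only [dependentRounding]
      rw [dif_pos h, if_neg h1]

/-- Weight 1 compares the number of selected candidates with `T`; acceptance probabilities as
weights give the mean number of acceptances. -/
theorem sum_mul_eq_sum_one_add_sum_fractional {n : ℕ} {y : Fin n → ℝ}
    (hy : ∀ i, 0 ≤ y i ∧ y i ≤ 1) (w : Fin n → ℝ) :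
    ∑ i, y i * w i
      = ∑ i ∈ Finset.univ.filter (fun i => y i = 1), w i + ∑ i ∈ fractional y, y i * w i := by
  rw [fractional, Finset.sum_filter, Finset.sum_filter, ← Finset.sum_add_distrib]
  refine Finset.sum_congr rfl fun i _ => ?_
  obtain ⟨h0, h1⟩ := hy i
  rcases h1.eq_or_lt with h1 | h1
  · simp [h1]
  rcases h0.eq_or_lt with h0 | h0
  · simp [← h0]
  simp [h0, h1, h1.ne]

/-- Keeps the hiring probability of a selected candidate from being the default value of 0/0 on
account of `y i = 0`. -/
theorem pos_of_mem_of_mem_support_dependentRounding {n : ℕ} {y : Fin n → ℝ} (hy : Roundable y)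
    {S : Finset (Fin n)} (hS : S ∈ (dependentRounding y).support) {i : Fin n} (hi : i ∈ S) :
    0 < y i := by
  have hone : ∀ i ∈ Finset.univ.filter (fun i => y i = 1), 0 < y i := by
    intro i hi
    rw [(Finset.mem_filter.1 hi).2]; exact one_pos
  have hfrac : ∀ i ∈ fractional y, 0 < y i := fun i hi => (Finset.mem_filter.1 hi).2.1
  rcases dependentRounding_cases y hy with ⟨_, h⟩ | ⟨a, ha, h⟩ | ⟨a, b, _, ha, _, h⟩
  · rw [h, PMF.support_pure, Set.mem_singleton_iff] at hS
    exact hone i (hS ▸ hi)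
  · rw [h, PMF.mem_support_map_iff] at hS
    obtain ⟨c, _, rfl⟩ := hS
    have := hfrac a (by simp [ha])
    cases c
    · exact hone i hi
    · rcases Finset.mem_insert.1 hi with rfl | hi
      · exact this
      · exact hone i hi
  · rw [h, PMF.mem_support_map_iff] at hS
    obtain ⟨c, _, rfl⟩ := hS
    have := hfrac a (by simp [ha])
    have := hfrac b (by simp [ha])
    cases c <;> rcases Finset.mem_insert.1 hi with rfl | hi <;> first | assumption | exact hone i hi

theorem List.filter_mem_insert_perm {α : Type*} [DecidableEq α] {L : List α} (hL : L.Nodup)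
    {S : Finset α} {i : α} (hi : i ∉ S) :
    (L.filter fun j => j ∈ insert i S).Perm
      (if i ∈ L then i :: L.filter fun j => j ∈ S else L.filter fun j => j ∈ S) := by
  split_ifs with h
  · rw [List.perm_ext_iff_of_nodup (hL.filter _)
      (List.nodup_cons.2 ⟨by simp [hi], hL.filter _⟩)]
    intro j
    simp only [List.mem_filter, Finset.mem_insert, decide_eq_true_eq, List.mem_cons]
    constructor
    · rintro ⟨h1, rfl | h2⟩ <;> simp_all
    · rintro (rfl | h2) <;> simp_all
  · apply List.Perm.of_eq
    apply List.filter_congr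
    intro j hj
    have : j ≠ i := fun e => h (e ▸ hj)
    simp [this]

/-- A candidate outside `L` enters with parameter 0, so that both cases have the shape to which
`shortfall_mix` applies. -/
theorem shortfall_filter_insert {α : Type*} [DecidableEq α] {L : List α} (hL : L.Nodup)
    {S : Finset α} {i : α} (hi : i ∉ S) (q : α → ℝ) (c : ℕ) :
    shortfall c ((L.filter fun j => j ∈ insert i S).map q)
      = shortfall c ((if i ∈ L then q i else 0) :: (L.filter fun j => j ∈ S).map q) := by
  rw [shortfall_perm ((List.filter_mem_insert_perm hL hi).map q) c]
  split_ifs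
  · rfl
  · rw [shortfall_zero_cons]

/-! ### Runs of the algorithm -/

namespace SeqInstance

variable (I : SeqInstance)

theorem isAdmissible_run (h : Fin I.n → ℝ) (L : List (Fin I.n))
    (hL : ∀ i ∈ L, 0 < I.q i → h i = 1) (o : Outcome I.n)
    (ho : o.offered.card ≤ I.T ∧ o.hired.card ≤ I.k ∧ o.hired = o.accepted) :
    I.IsAdmissible (I.run h L o) := by
  induction L generalizing o with
  | nil =>
    intro o' h'
    rw [run, PMF.support_pure, Set.mem_singleton_iff] at h'
    rwa [h']
  | cons i L ih =>
    intro o' h'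
    rw [run] at h'
    split_ifs at h' with hc
    · rw [PMF.mem_support_bind_iff] at h'
      obtain ⟨a, ha, h'⟩ := h'
      rw [PMF.mem_support_bind_iff] at h'
      obtain ⟨b, hb, h'⟩ := h'
      refine ih (fun j hj => hL j (List.mem_cons_of_mem _ hj)) _ ?_ o' h'
      refine ⟨(Finset.card_insert_le _ _).trans hc.1, ?_, ?_⟩
      · dsimp only
        split_ifs
        · exact (Finset.card_insert_le _ _).trans hc.2
        · exact ho.2.1
      · cases a
        · simpa using ho.2.2
        · rw [hL i List.mem_cons_self (pos_of_true_mem_support_coin ha)] at hb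
          cases b
          · exact absurd hb false_notMem_support_coin_one
          · simp [ho.2.2]
    · rw [PMF.support_pure, Set.mem_singleton_iff] at h'
      rwa [h']

theorem hired_subset_of_mem_support_run (h : Fin I.n → ℝ) (L : List (Fin I.n)) (o : Outcome I.n) :
    ∀ o' ∈ (I.run h L o).support, o.hired ⊆ o'.hired := by
  induction L generalizing o with
  | nil =>
    intro o' h'
    rw [run, PMF.support_pure, Set.mem_singleton_iff] at h'
    rw [h']
  | cons i L ih =>
    intro o' h'
    rw [run] at h'
    split_ifs at h' with hc
    · rw [PMF.mem_support_bind_iff] at h'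
      obtain ⟨a, ha, h'⟩ := h'
      rw [PMF.mem_support_bind_iff] at h'
      obtain ⟨b, hb, h'⟩ := h'
      refine subset_trans ?_ (ih _ o' h')
      dsimp only
      split_ifs
      · exact Finset.subset_insert _ _
      · exact subset_rfl
    · rw [PMF.support_pure, Set.mem_singleton_iff] at h'
      rw [h']

theorem card_hired_le_expect_run (h : Fin I.n → ℝ) (P : Finset (Fin I.n)) (L : List (Fin I.n))
    (o : Outcome I.n) (hoP : o.hired ⊆ P) : (o.hired.card : ℝ)
      ≤ ((I.run h L o).map Outcome.hired).expect fun H => ((H ∩ P).card : ℝ) := by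
  apply PMF.le_expect
  intro H hH
  obtain ⟨o', ho', rfl⟩ := (PMF.mem_support_map_iff _ _ _).1 hH
  exact_mod_cast Finset.card_le_card
    (Finset.subset_inter (I.hired_subset_of_mem_support_run h L o o' ho') hoP)

/-- Lower bound for the expected number of hires from the set `P` when the candidates of `P` are
processed first. -/
theorem sub_shortfall_le_expect_run (h : Fin I.n → ℝ) (h01 : ∀ i, 0 ≤ h i ∧ h i ≤ 1)
    (P : Finset (Fin I.n)) (L₁ L₂ : List (Fin I.n)) (hP : ∀ i ∈ L₁, i ∈ P) (hd : L₁.Nodup)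
    (hq : ∀ i ∈ L₁, I.q i * h i = I.q i) (o : Outcome I.n) (hoP : o.hired ⊆ P)
    (hoL : ∀ i ∈ L₁, i ∉ o.hired) (hT : o.offered.card + L₁.length ≤ I.T)
    (hk : o.hired.card ≤ I.k) :
    (I.k : ℝ) - shortfall (I.k - o.hired.card) (L₁.map I.q)
      ≤ ((I.run h (L₁ ++ L₂) o).map Outcome.hired).expect fun H => ((H ∩ P).card : ℝ) := by
  induction L₁ generalizing o with
  | nil =>
    simp only [List.map_nil, shortfall, List.nil_append]
    rw [Nat.cast_sub hk]
    simpa using I.card_hired_le_expect_run h P L₂ o hoP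
  | cons i L ih =>
    rcases hk.eq_or_lt with hk' | hk'
    -- All positions are filled, by members of `P`, and hires are never undone.
    · rw [hk', Nat.sub_self, shortfall_zero, sub_zero]
      exact hk' ▸ I.card_hired_le_expect_run h P _ o hoP
    obtain ⟨hiL, hd'⟩ := List.nodup_cons.1 hd
    have hio := hoL i List.mem_cons_self
    simp only [List.length_cons] at hT
    have hoff : (insert i o.offered).card + L.length ≤ I.T := by
      have := Finset.card_insert_le i o.offered
      omega
    have ih := ih (fun j hj => hP j (List.mem_cons_of_mem _ hj)) hd'
      (fun j hj => hq j (List.mem_cons_of_mem _ hj))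
    have keep : ∀ A : Finset (Fin I.n), (I.k : ℝ) - shortfall (I.k - o.hired.card) (L.map I.q)
        ≤ ((I.run h (L ++ L₂) ⟨insert i o.offered, A, o.hired⟩).map Outcome.hired).expect
          fun H => ((H ∩ P).card : ℝ) := fun A =>
      ih ⟨insert i o.offered, A, o.hired⟩ hoP
        (fun j hj => hoL j (List.mem_cons_of_mem _ hj)) hoff hk
    have hire : ∀ A : Finset (Fin I.n),
        (I.k : ℝ) - shortfall (I.k - o.hired.card - 1) (L.map I.q)
        ≤ ((I.run h (L ++ L₂) ⟨insert i o.offered, A, insert i o.hired⟩).map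
          Outcome.hired).expect fun H => ((H ∩ P).card : ℝ) := fun A => by
      have hsub : insert i o.hired ⊆ P :=
        Finset.insert_subset (hP i List.mem_cons_self) hoP
      have hcard : (insert i o.hired).card = o.hired.card + 1 := Finset.card_insert_of_notMem hio
      have := ih ⟨insert i o.offered, A, insert i o.hired⟩ hsub
        (fun j hj => by
          rw [Finset.mem_insert, not_or]
          exact ⟨fun e => hiL (e ▸ hj), hoL j (List.mem_cons_of_mem _ hj)⟩) hoff
        (by rw [hcard]; omega)
      dsimp only at this
      rwa [hcard, ← Nat.sub_sub] at this
    have hi := hq i List.mem_cons_self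
    obtain ⟨hh0, hh1⟩ := h01 i
    have hq0 := I.q_nonneg i
    have hq1 := I.q_le_one i
    rw [List.cons_append, run, if_pos ⟨by omega, hk'⟩]
    simp only [PMF.map_bind, PMF.expect_bind, PMF.expect_coin hq0 hq1, PMF.expect_coin hh0 hh1,
      Bool.and_true, Bool.and_false, if_true, Bool.false_eq_true, if_false]
    simp only [List.map_cons, shortfall]
    have e1 := mul_le_mul_of_nonneg_left (hire (insert i o.accepted)) (mul_nonneg hq0 hh0)
    have e2 := mul_le_mul_of_nonneg_left (keep (insert i o.accepted))
      (mul_nonneg hq0 (sub_nonneg.2 hh1))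
    have e3 := mul_le_mul_of_nonneg_left (keep o.accepted) (mul_nonneg (sub_nonneg.2 hq1) hh0)
    have e4 := mul_le_mul_of_nonneg_left (keep o.accepted)
      (mul_nonneg (sub_nonneg.2 hq1) (sub_nonneg.2 hh1))
    -- The branch in which an acceptance is refused has probability 0. This also covers `q i = 0`,
    -- where `h i` may differ from 1.
    have e5 : I.q i * (1 - h i) = 0 := by rw [mul_sub, hi]; ring
    rw [e5] at e2
    rw [hi] at e1
    rw [mul_add, mul_add, ← mul_assoc, ← mul_assoc, ← mul_assoc, ← mul_assoc, e5, hi]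
    linarith

end SeqInstance

theorem PMF.expect_map {α β : Type*} [Fintype α] [Fintype β] (p : PMF α) (g : α → β)
    (f : β → ℝ) : (p.map g).expect f = p.expect fun a => f (g a) := by
  rw [PMF.map, PMF.expect_bind]
  simp only [Function.comp_apply, PMF.expect_pure]

theorem List.sum_map_eq_sum_ite {α : Type*} [Fintype α] [DecidableEq α] {L : List α}
    (hL : L.Nodup) (f : α → ℝ) : (L.map f).sum = ∑ i, if i ∈ L then f i else 0 := by
  rw [← List.sum_toFinset f hL, ← Finset.sum_filter]
  refine Finset.sum_congr ?_ fun _ _ => rfl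
  ext i; simp

/-! ### Prefix bounds and the expected reward -/

namespace SeqInstance

variable (I : SeqInstance)

theorem hireProb_mem {s : (Fin I.n → ℝ) × (Fin I.n → ℝ)} (hs : s ∈ I.ptkFeasible)
    (i : Fin I.n) : 0 ≤ I.hireProb s i ∧ I.hireProb s i ≤ 1 := by
  obtain ⟨h1, _, _, h4, h5⟩ := hs
  have h0 := mul_nonneg (h5 i).1 (I.q_nonneg i)
  exact ⟨div_nonneg (h4 i) h0, div_le_one_of_le₀ (h1 i) h0⟩

theorem hireProb_eq_one {s : (Fin I.n → ℝ) × (Fin I.n → ℝ)} (ht : I.IsTight s) {i : Fin I.n}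
    (hy : 0 < s.2 i) (hq : 0 < I.q i) : I.hireProb s i = 1 := by
  rw [hireProb, ht i]
  exact div_self (mul_pos hy hq).ne'

theorem isAdmissible_alg {s : (Fin I.n → ℝ) × (Fin I.n → ℝ)} (ht : I.IsTight s)
    (hr : Roundable s.2) (σ : Equiv.Perm (Fin I.n)) : I.IsAdmissible (I.alg s σ) := by
  intro o ho
  rw [alg, PMF.mem_support_bind_iff] at ho
  obtain ⟨S, hS, ho⟩ := ho
  refine I.isAdmissible_run _ _ (fun i hi hq => I.hireProb_eq_one ht ?_ hq) _ ?_ o ho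
  · exact pos_of_mem_of_mem_support_dependentRounding hr hS
      (by simpa using (List.mem_filter.1 hi).2)
  · simp

theorem sub_shortfall_le_expect_run_filter {s : (Fin I.n → ℝ) × (Fin I.n → ℝ)}
    (hs : s ∈ I.ptkFeasible) (ht : I.IsTight s) {L₁ : List (Fin I.n)} (hd : L₁.Nodup)
    (L₂ : List (Fin I.n)) {S : Finset (Fin I.n)} (hS : ∀ i ∈ S, 0 < s.2 i) (hT : S.card ≤ I.T) :
    (I.k : ℝ) - shortfall I.k ((L₁.filter fun i => i ∈ S).map I.q)
      ≤ ((I.run (I.hireProb s) ((L₁ ++ L₂).filter fun i => i ∈ S) ⟨∅, ∅, ∅⟩).map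
        Outcome.hired).expect fun H => ((H ∩ L₁.toFinset).card : ℝ) := by
  rw [List.filter_append]
  refine I.sub_shortfall_le_expect_run (I.hireProb s) (I.hireProb_mem hs) L₁.toFinset
    (L₁.filter fun i => i ∈ S) (L₂.filter fun i => i ∈ S) ?_ (hd.filter _) ?_ ⟨∅, ∅, ∅⟩ (by simp)
    (by simp) ?_ (by simp)
  · intro i hi
    simpa using List.mem_of_mem_filter hi
  · intro i hi
    rcases (I.q_nonneg i).eq_or_lt with hq | hq
    · simp [← hq]
    · rw [I.hireProb_eq_one ht (hS i (by simpa using (List.mem_filter.1 hi).2)) hq, mul_one]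
  · rw [Finset.card_empty, zero_add, ← List.toFinset_card_of_nodup (hd.filter _)]
    refine (Finset.card_le_card fun i hi => ?_).trans hT
    simp only [List.mem_toFinset, List.mem_filter, decide_eq_true_eq] at hi
    exact hi.2

/-- Conditioning on the rounding and averaging merges the fractional candidates into one Bernoulli
variable beside those of the candidates with `y i = 1`. Its parameter is ∑ y i · a i over the
fractional i, so the total mean is the LP mass of the prefix and `le_sub_shortfall` applies. -/
theorem le_expect_alg_prefix {s : (Fin I.n → ℝ) × (Fin I.n → ℝ)} (hs : s ∈ I.ptkFeasible)
    (ht : I.IsTight s) (hr : Roundable s.2) (σ : Equiv.Perm (Fin I.n)) {L₁ L₂ : List (Fin I.n)}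
    (hL : (List.finRange I.n).map σ = L₁ ++ L₂) (hd : L₁.Nodup) :
    (1 - Real.exp (-(I.k : ℝ)) * (I.k : ℝ) ^ I.k / (I.k ! : ℝ)) * (L₁.map s.1).sum
      ≤ ((I.alg s σ).map Outcome.hired).expect fun H => ((H ∩ L₁.toFinset).card : ℝ) := by
  set S₀ : Finset (Fin I.n) := Finset.univ.filter fun i => s.2 i = 1 with hS₀
  set l₀ : List ℝ := (L₁.filter fun i => i ∈ S₀).map I.q with hl₀
  set a : Fin I.n → ℝ := fun i => if i ∈ L₁ then I.q i else 0 with ha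
  have hy := hs.2.2.2.2
  have ha01 : ∀ i, 0 ≤ a i ∧ a i ≤ 1 := fun i => by
    simp only [ha]
    split_ifs
    · exact ⟨I.q_nonneg i, I.q_le_one i⟩
    · simp
  have hl₀01 : ∀ b ∈ l₀, 0 ≤ b ∧ b ≤ 1 := fun b hb => by
    obtain ⟨i, _, rfl⟩ := List.mem_map.1 hb
    exact ⟨I.q_nonneg i, I.q_le_one i⟩
  have hsum : (L₁.map s.1).sum = l₀.sum + ∑ i ∈ fractional s.2, s.2 i * a i := by
    rw [List.sum_map_eq_sum_ite hd, List.sum_map_eq_sum_ite (hd.filter _)]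
    have e1 : ∀ i, (if i ∈ L₁ then s.1 i else 0) = s.2 i * a i := fun i => by
      simp only [ha, ht i]; split_ifs <;> simp
    simp_rw [e1]
    rw [sum_mul_eq_sum_one_add_sum_fractional hy, Finset.sum_filter]
    congr 1
    refine Finset.sum_congr rfl fun i _ => ?_
    simp only [ha, hS₀, List.mem_filter, Finset.mem_filter, Finset.mem_univ, true_and,
      decide_eq_true_eq]
    by_cases h1 : s.2 i = 1 <;> by_cases h2 : i ∈ L₁ <;> simp [h1, h2]
  have hcard : (S₀.card : ℝ) + ∑ i ∈ fractional s.2, s.2 i ≤ I.T := by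
    have := sum_mul_eq_sum_one_add_sum_fractional hy fun _ => 1
    simp only [mul_one, Finset.sum_const, nsmul_eq_mul] at this
    rw [← this]
    exact hs.2.1
  have hpos₀ : ∀ i ∈ S₀, 0 < s.2 i := fun i hi => by
    rw [(Finset.mem_filter.1 hi).2]; exact one_pos
  have hsumk : (L₁.map s.1).sum ≤ I.k := by
    rw [← List.sum_toFinset _ hd]
    exact (Finset.sum_le_univ_sum_of_nonneg hs.2.2.2.1).trans hs.2.2.1
  have hfrac : ∀ i ∈ fractional s.2, i ∉ S₀ ∧ 0 < s.2 i := fun i hi => by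
    have := (Finset.mem_filter.1 hi).2
    exact ⟨fun h => this.2.ne (Finset.mem_filter.1 h).2, this.1⟩
  suffices H : ∃ l : List ℝ, (∀ b ∈ l, 0 ≤ b ∧ b ≤ 1) ∧ l.sum = (L₁.map s.1).sum ∧
      (I.k : ℝ) - shortfall I.k l
        ≤ ((I.alg s σ).map Outcome.hired).expect fun H => ((H ∩ L₁.toFinset).card : ℝ) by
    obtain ⟨l, hl, hls, hle⟩ := H
    rw [← hls] at hsumk ⊢
    exact (le_sub_shortfall I.one_le_k l hl hsumk).trans hle
  rw [alg, PMF.map_bind, PMF.expect_bind, hL]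
  have hΦ := fun S hS hT => I.sub_shortfall_le_expect_run_filter hs ht hd L₂ (S := S) hS hT
  -- Cardinalities are integers, so a strict inequality leaves room for one more offer.
  have hinsert : ∀ i ∈ fractional s.2, (S₀.card : ℝ) < I.T →
      (I.k : ℝ) - shortfall I.k (a i :: l₀)
        ≤ ((I.run (I.hireProb s) ((L₁ ++ L₂).filter fun j => j ∈ insert i S₀) ⟨∅, ∅, ∅⟩).map
          Outcome.hired).expect fun H => ((H ∩ L₁.toFinset).card : ℝ) := fun i hi hlt => by
    rw [← shortfall_filter_insert hd (hfrac i hi).1]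
    refine hΦ _ ?_ ?_
    · intro j hj
      rcases Finset.mem_insert.1 hj with rfl | hj
      · exact (hfrac j hi).2
      · exact hpos₀ j hj
    · rw [Finset.card_insert_of_notMem (hfrac i hi).1]
      have : S₀.card < I.T := by exact_mod_cast hlt
      omega
  rcases dependentRounding_cases s.2 hr with ⟨hf, h⟩ | ⟨i, hf, h⟩ | ⟨i, j, hij, hf, h1, h⟩
  · refine ⟨l₀, hl₀01, by rw [hsum, hf]; simp, ?_⟩
    rw [h, PMF.expect_pure]
    refine hΦ S₀ hpos₀ ?_
    rw [hf, Finset.sum_empty, add_zero] at hcard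
    exact_mod_cast hcard
  · have hi := hy i
    have hif : i ∈ fractional s.2 := by simp [hf]
    rw [hf, Finset.sum_singleton] at hcard hsum
    have hlt : (S₀.card : ℝ) < I.T := by linarith [(hfrac i hif).2]
    -- Not selecting `i` counts as a Bernoulli variable of parameter 0.
    refine ⟨(s.2 i * a i + (1 - s.2 i) * 0) :: l₀, ?_, by rw [hsum, List.sum_cons]; ring, ?_⟩
    · intro b hb
      rcases List.mem_cons.1 hb with rfl | hb
      · rw [mul_zero, add_zero]
        exact ⟨mul_nonneg hi.1 (ha01 i).1, mul_le_one₀ hi.2 (ha01 i).1 (ha01 i).2⟩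
      · exact hl₀01 b hb
    · rw [h, PMF.expect_map, PMF.expect_coin hi.1 hi.2, ← shortfall_mix, shortfall_zero_cons]
      simp only [if_true, Bool.false_eq_true, if_false]
      have e1 := mul_le_mul_of_nonneg_left (hinsert i hif hlt) hi.1
      have e2 := mul_le_mul_of_nonneg_left (hΦ S₀ hpos₀ (by exact_mod_cast hlt.le))
        (sub_nonneg.2 hi.2)
      linarith
  · have hi := hy i
    have hif : i ∈ fractional s.2 := by simp [hf]
    have hjf : j ∈ fractional s.2 := by simp [hf]
    rw [hf, Finset.sum_pair hij] at hcard hsum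
    have hlt : (S₀.card : ℝ) < I.T := by linarith
    have hj : s.2 j = 1 - s.2 i := by linarith
    refine ⟨(s.2 i * a i + (1 - s.2 i) * a j) :: l₀, ?_,
      by rw [hsum, List.sum_cons, hj]; ring, ?_⟩
    · intro b hb
      rcases List.mem_cons.1 hb with rfl | hb
      · have := convex_Icc (0 : ℝ) 1 (ha01 i) (ha01 j) hi.1 (sub_nonneg.2 hi.2) (by ring)
        exact this
      · exact hl₀01 b hb
    · rw [h, PMF.expect_map, PMF.expect_coin hi.1 hi.2, ← shortfall_mix]
      simp only [if_true, Bool.false_eq_true, if_false]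
      have e1 := mul_le_mul_of_nonneg_left (hinsert i hif hlt) hi.1
      have e2 := mul_le_mul_of_nonneg_left (hinsert j hjf hlt) (sub_nonneg.2 hi.2)
      linarith

theorem LPseq_le_ptkObjective {s : (Fin I.n → ℝ) × (Fin I.n → ℝ)} (hs : I.IsPtkOptimal s) :
    I.LPseq ≤ I.ptkObjective s := by
  refine csSup_le (Set.Nonempty.image _ ⟨0, ?_⟩) ?_
  · simp [seqFeasible]
  · rintro _ ⟨y, ⟨h1, h2, h3⟩, rfl⟩
    have : ((fun i => y i * I.q i, y) : (Fin I.n → ℝ) × (Fin I.n → ℝ)) ∈ I.ptkFeasible :=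
      ⟨fun _ => le_rfl, h1, h2, fun i => mul_nonneg (h3 i).1 (I.q_nonneg i), h3⟩
    refine le_trans (le_of_eq ?_) (hs.2 this)
    simp [ptkObjective, mul_assoc]

theorem le_expectedReward_alg {s : (Fin I.n → ℝ) × (Fin I.n → ℝ)} (hs : I.IsPtkOptimal s)
    (ht : I.IsTight s) (hr : Roundable s.2) (σ : Equiv.Perm (Fin I.n))
    (hσ : Antitone fun a => I.value s (σ a)) :
    (1 - Real.exp (-(I.k : ℝ)) * (I.k : ℝ) ^ I.k / (I.k ! : ℝ)) * I.LPseq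
      ≤ I.expectedReward (I.alg s σ) := by
  refine (mul_le_mul_of_nonneg_left (I.LPseq_le_ptkObjective hs)
    (one_sub_exp_mul_pow_div_factorial_nonneg I.k)).trans ?_
  set γ := 1 - Real.exp (-(I.k : ℝ)) * (I.k : ℝ) ^ I.k / (I.k ! : ℝ)
  set μ := (I.alg s σ).map Outcome.hired with hμ
  set P : Fin I.n → ℝ := fun i => μ.expect fun H => if i ∈ H then 1 else 0 with hP
  set L := (List.finRange I.n).map σ with hLdef
  have hd : L.Nodup := (List.nodup_finRange _).map σ.injective
  have hmem : ∀ i, i ∈ L := fun i =>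
    List.mem_map.2 ⟨σ.symm i, List.mem_finRange _, σ.apply_symm_apply i⟩
  have hPnonneg : ∀ i, 0 ≤ P i := fun i => μ.expect_nonneg _ fun H => by split_ifs <;> simp
  have hv0 : ∀ i, 0 ≤ I.value s i := fun i =>
    div_nonneg (mul_nonneg (I.r_nonneg i) (hs.1.2.2.2.1 i)) (hs.1.2.2.2.1 i)
  -- The value differs from `r i` only where `x i = 0`. Replacing `r` by it can only lower the
  -- reward and leaves the LP objective unchanged.
  have hvr : ∀ i, I.value s i ≤ I.r i := fun i => by
    rw [value]
    rcases eq_or_ne (s.1 i) 0 with h | h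
    · simp [h, I.r_nonneg i]
    · rw [mul_div_cancel_right₀ _ h]
  have hvx : ∀ i, I.value s i * s.1 i = I.r i * s.1 i := fun i => by
    rw [value]
    rcases eq_or_ne (s.1 i) 0 with h | h
    · simp [h]
    · rw [mul_div_cancel_right₀ _ h]
  have hrew : I.expectedReward (I.alg s σ) = ∑ i, I.r i * P i := by
    have : I.expectedReward (I.alg s σ)
        = μ.expect fun H => ∑ i, I.r i * if i ∈ H then 1 else 0 := by
      simp [expectedReward, PMF.expect, hμ]
    rw [this, PMF.expect_sum]
    simp only [PMF.expect_mul_left, hP]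
  have key := List.sum_map_mul_nonneg_of_prefix (fun i => P i - γ * s.1 i) (I.value s) hv0 L
    (by
      rw [hLdef, List.pairwise_map]
      exact (List.pairwise_le_finRange I.n).imp fun h => hσ h)
    fun L₁ L₂ e => by
      have hd₁ : L₁.Nodup := (List.nodup_append.1 (e ▸ hd)).1
      have h1 := I.le_expect_alg_prefix hs.1 ht hr σ e hd₁
      have h2 : (μ.expect fun H => ((H ∩ L₁.toFinset).card : ℝ)) = (L₁.map P).sum := by
        rw [← List.sum_toFinset _ hd₁]
        simp only [hP]
        rw [← PMF.expect_sum]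
        congr 1
        funext H
        rw [Finset.sum_boole, Finset.inter_comm, Finset.filter_mem_eq_inter]
      rw [← hμ, h2] at h1
      rw [← List.sum_toFinset _ hd₁] at h1 h2 ⊢
      rw [← List.sum_toFinset _ hd₁] at h1
      rw [Finset.sum_sub_distrib, ← Finset.mul_sum]
      linarith
  rw [List.sum_map_eq_sum_ite hd] at key
  simp only [hmem, if_true] at key
  have e : ∑ i, (P i - γ * s.1 i) * I.value s i
      = ∑ i, I.value s i * P i - γ * I.ptkObjective s := by
    rw [ptkObjective, Finset.mul_sum, ← Finset.sum_sub_distrib]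
    refine Finset.sum_congr rfl fun i _ => ?_
    rw [← hvx]; ring
  have hle : ∑ i, I.value s i * P i ≤ ∑ i, I.r i * P i :=
    Finset.sum_le_sum fun i _ => mul_le_mul_of_nonneg_right (hvr i) (hPnonneg i)
  rw [hrew]
  linarith

end SeqInstance

/-! ### Vertices of the linear program -/

open Filter Topology in
theorem eventually_add_mul_lt {a b c d : ℝ} (h : a < c) :
    ∀ᶠ δ in 𝓝 (0 : ℝ), a + δ * b < c + δ * d := by
  have h1 : Tendsto (fun δ : ℝ => a + δ * b) (𝓝 0) (𝓝 a) := by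
    have : Continuous fun δ : ℝ => a + δ * b := by fun_prop
    simpa using this.tendsto 0
  have h2 : Tendsto (fun δ : ℝ => c + δ * d) (𝓝 0) (𝓝 c) := by
    have : Continuous fun δ : ℝ => c + δ * d := by fun_prop
    simpa using this.tendsto 0
  exact h1.eventually_lt h2 h

namespace SeqInstance

variable (I : SeqInstance)

theorem isCompact_ptkFeasible : IsCompact I.ptkFeasible := by
  have hK : IsCompact ((Set.univ.pi fun _ => Set.Icc 0 1 : Set (Fin I.n → ℝ)) ×ˢ
      (Set.univ.pi fun _ => Set.Icc 0 1 : Set (Fin I.n → ℝ))) :=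
    (isCompact_univ_pi fun _ => isCompact_Icc).prod (isCompact_univ_pi fun _ => isCompact_Icc)
  refine hK.of_isClosed_subset ?_ ?_
  · simp only [ptkFeasible, Set.ofPred_and, Set.ofPred_forall]
    refine ((isClosed_iInter fun i => isClosed_le (by fun_prop) (by fun_prop)).inter ?_)
    refine (isClosed_le (by fun_prop) (by fun_prop)).inter ?_
    refine (isClosed_le (by fun_prop) (by fun_prop)).inter ?_
    refine (isClosed_iInter fun i => isClosed_le (by fun_prop) (by fun_prop)).inter ?_
    exact isClosed_iInter fun i => (isClosed_le (by fun_prop) (by fun_prop)).inter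
      (isClosed_le (by fun_prop) (by fun_prop))
  · rintro s ⟨h1, _, _, h4, h5⟩
    refine ⟨fun i _ => ⟨h4 i, (h1 i).trans ?_⟩, fun i _ => h5 i⟩
    exact mul_le_one₀ (h5 i).2 (I.q_nonneg i) (I.q_le_one i)

theorem continuous_ptkObjective : Continuous I.ptkObjective := by
  unfold ptkObjective
  fun_prop

/-- The objective involves only x, so in an optimal solution `y i` may be lowered to `x i / q i`. If
`q i = 0`, then `x i = 0` and the default quotient 0 serves. -/
theorem exists_isPtkOptimal_isTight : ∃ s, I.IsPtkOptimal s ∧ I.IsTight s := by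
  have hne : I.ptkFeasible.Nonempty := ⟨0, by simp [ptkFeasible]⟩
  obtain ⟨s, hs, hmax⟩ :=
    I.isCompact_ptkFeasible.exists_isMaxOn hne I.continuous_ptkObjective.continuousOn
  obtain ⟨h1, h2, h3, h4, h5⟩ := hs
  have hle : ∀ i, s.1 i / I.q i ≤ s.2 i := fun i => div_le_of_le_mul₀ (I.q_nonneg i) (h5 i).1 (h1 i)
  have htight : I.IsTight (s.1, fun i => s.1 i / I.q i) := fun i => by
    dsimp only
    rcases eq_or_ne (I.q i) 0 with hq | hq
    · have := h1 i
      rw [hq, mul_zero] at this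
      rw [hq, mul_zero]
      exact le_antisymm this (h4 i)
    · rw [div_mul_cancel₀ _ hq]
  refine ⟨(s.1, fun i => s.1 i / I.q i), ⟨⟨fun i => (htight i).le, ?_, h3, h4, fun i => ?_⟩, hmax⟩,
    htight⟩
  · exact (Finset.sum_le_sum fun i _ => hle i).trans h2
  · exact ⟨div_nonneg (h4 i) (I.q_nonneg i), (hle i).trans (h5 i).2⟩

/-- Optimality and tightness both say that a linear inequality valid on the region holds with
equality; equality at an interior point of a segment forces it at the endpoints. -/
theorem isExtreme_optimal_tight :
    IsExtreme ℝ I.ptkFeasible {s | I.IsPtkOptimal s ∧ I.IsTight s} := by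
  refine ⟨fun s hs => hs.1.1, ?_⟩
  rintro s hs s' hs' _ ⟨hopt, ht⟩ ⟨a, b, ha, hb, hab, rfl⟩
  have hmax : I.ptkObjective (a • s + b • s') ≤ I.ptkObjective s := by
    have h1 := hopt.2 hs'
    have h2 : I.ptkObjective (a • s + b • s') = a * I.ptkObjective s + b * I.ptkObjective s' := by
      simp only [ptkObjective, Finset.mul_sum, ← Finset.sum_add_distrib]
      refine Finset.sum_congr rfl fun i _ => ?_
      simp
      ring
    have h3 := mul_le_mul_of_nonneg_left h1 hb.le
    have h4 : a * I.ptkObjective (a • s + b • s') ≤ a * I.ptkObjective s := by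
      have : a = 1 - b := by linarith
      have e : a * I.ptkObjective (a • s + b • s') = I.ptkObjective (a • s + b • s')
          - b * I.ptkObjective (a • s + b • s') := by rw [this]; ring
      linarith
    exact le_of_mul_le_mul_left h4 ha
  refine ⟨⟨hs, fun t ht => (hopt.2 ht).trans hmax⟩, fun i => ?_⟩
  have h1 := hs.1 i
  have h2 := hs'.1 i
  have h3 := ht i
  simp only [Prod.fst_add, Prod.smul_fst, Prod.snd_add, Prod.smul_snd, Pi.add_apply,
    Pi.smul_apply, smul_eq_mul] at h3
  have h4 := mul_le_mul_of_nonneg_left h2 hb.le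
  refine le_antisymm h1 (le_of_mul_le_mul_left ?_ ha)
  linarith

theorem exists_isPtkBasic_isPtkOptimal_isTight :
    ∃ s, I.IsPtkBasic s ∧ I.IsPtkOptimal s ∧ I.IsTight s := by
  obtain ⟨s₀, h₀, ht₀⟩ := I.exists_isPtkOptimal_isTight
  have hcomp : IsCompact {s | I.IsPtkOptimal s ∧ I.IsTight s} := by
    refine I.isCompact_ptkFeasible.of_isClosed_subset ?_ fun s hs => hs.1.1
    simp only [IsPtkOptimal, IsTight, isMaxOn_iff, Set.ofPred_and, Set.ofPred_forall, Set.ofPred_mem_eq]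
    refine (I.isCompact_ptkFeasible.isClosed.inter ?_).inter ?_
    · exact isClosed_iInter fun t => isClosed_iInter fun _ =>
        isClosed_le continuous_const I.continuous_ptkObjective
    · exact isClosed_iInter fun i => isClosed_eq (by fun_prop) (by fun_prop)
  obtain ⟨s, hs⟩ := hcomp.extremePoints_nonempty ⟨s₀, h₀, ht₀⟩
  exact ⟨s, I.isExtreme_optimal_tight.extremePoints_subset_extremePoints hs, hs.1⟩

/-- The rate at which `x i` moves with `y i` along feasible perturbations. -/
noncomputable def tightRate (s : (Fin I.n → ℝ) × (Fin I.n → ℝ)) (i : Fin I.n) : ℝ :=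
  if s.1 i = s.2 i * I.q i then I.q i else 0

open Filter Topology in
-- Tight constraints stay tight because `x i` follows `y i` at rate `q i`; where `x i < y i * q i`,
-- `x i` stays fixed. The remaining affected constraints are strict and survive small changes.
theorem eventually_perturb_mem_ptkFeasible {s : (Fin I.n → ℝ) × (Fin I.n → ℝ)}
    (hs : s ∈ I.ptkFeasible) (t : Fin I.n → ℝ) (hsupp : ∀ i, t i ≠ 0 → i ∈ fractional s.2)
    (hx : ∑ i, t i * I.tightRate s i = 0) (hy : ∑ i, t i = 0 ∨ ∑ i, s.2 i < I.T) :
    ∀ᶠ δ in 𝓝 (0 : ℝ), s + δ • ((fun i => t i * I.tightRate s i, t) :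
      (Fin I.n → ℝ) × (Fin I.n → ℝ)) ∈ I.ptkFeasible := by
  obtain ⟨h1, h2, h3, h4, h5⟩ := hs
  simp only [ptkFeasible, Set.mem_ofPred_eq, Prod.fst_add, Prod.smul_fst, Prod.snd_add,
    Prod.smul_snd, Pi.add_apply, Pi.smul_apply, smul_eq_mul, Finset.sum_add_distrib,
    ← Finset.mul_sum, hx]
  have hf : ∀ i, t i ≠ 0 → 0 < s.2 i ∧ s.2 i < 1 := fun i hi => by
    simpa [fractional] using hsupp i hi
  refine .and (eventually_all.2 fun i => ?_) (.and ?_ (.and ?_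
    (.and (eventually_all.2 fun i => ?_) (eventually_all.2 fun i => .and ?_ ?_))))
  · by_cases hi : s.1 i = s.2 i * I.q i
    · refine .of_forall fun δ => le_of_eq ?_
      rw [tightRate, if_pos hi, hi]; ring
    · have := eventually_add_mul_lt (b := t i * I.tightRate s i) (d := t i * I.q i)
        (lt_of_le_of_ne (h1 i) hi)
      filter_upwards [this] with δ hδ
      linarith
  · rcases hy with hy | hy
    · simp [hy, h2]
    · filter_upwards [eventually_add_mul_lt (b := ∑ i, t i) (d := 0) hy] with δ hδ
      linarith
  · simp [h3]
  · by_cases hti : t i = 0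
    · simp [hti, h4 i]
    by_cases hi : s.1 i = s.2 i * I.q i
    · rcases (I.q_nonneg i).eq_or_lt with hq | hq
      · simp [tightRate, ← hq, h4 i]
      · have : 0 < s.1 i := hi ▸ mul_pos (hf i hti).1 hq
        filter_upwards [eventually_add_mul_lt (b := 0) (d := t i * I.tightRate s i) this]
          with δ hδ
        linarith
    · simp [tightRate, hi, h4 i]
  · by_cases hti : t i = 0
    · simp [hti, (h5 i).1]
    · filter_upwards [eventually_add_mul_lt (b := 0) (d := t i) (hf i hti).1] with δ hδ
      linarith
  · by_cases hti : t i = 0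
    · simp [hti, (h5 i).2]
    · filter_upwards [eventually_add_mul_lt (b := t i) (d := 0) (hf i hti).2] with δ hδ
      linarith

open Filter Topology in
-- Otherwise the vertex would be the midpoint of two distinct feasible points, `s + δ • d` and `s -
-- δ • d`.
theorem IsPtkBasic.perturb_eq_zero {I : SeqInstance} {s : (Fin I.n → ℝ) × (Fin I.n → ℝ)}
    (hs : I.IsPtkBasic s) (t : Fin I.n → ℝ) (hsupp : ∀ i, t i ≠ 0 → i ∈ fractional s.2)
    (hx : ∑ i, t i * I.tightRate s i = 0) (hy : ∑ i, t i = 0 ∨ ∑ i, s.2 i < I.T) : t = 0 := by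
  set d : (Fin I.n → ℝ) × (Fin I.n → ℝ) := (fun i => t i * I.tightRate s i, t) with hd
  have h := I.eventually_perturb_mem_ptkFeasible hs.1 t hsupp hx hy
  have hneg : Tendsto (fun δ : ℝ => -δ) (𝓝 0) (𝓝 0) := by
    simpa using (continuous_neg (G := ℝ)).tendsto 0
  obtain ⟨δ, ⟨hδ1, hδ2⟩, hδ⟩ := (((h.and (hneg.eventually h)).filter_mono
    nhdsWithin_le_nhds).and (self_mem_nhdsWithin (s := Set.Ioi (0 : ℝ)))).exists
  have hδ : 0 < δ := hδ
  have := hs.2 hδ1 hδ2 ⟨1 / 2, 1 / 2, by norm_num, by norm_num, by norm_num, by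
    rw [← hd]; module⟩
  have h0 : δ • d = 0 := left_eq_add.1 this.symm
  have h0 : d = 0 := (smul_eq_zero.1 h0).resolve_left hδ.ne'
  exact congrArg Prod.snd h0

theorem IsPtkBasic.perturb_pair {I : SeqInstance} {s : (Fin I.n → ℝ) × (Fin I.n → ℝ)}
    (hs : I.IsPtkBasic s) {a b : Fin I.n} (hab : a ≠ b) (ha : a ∈ fractional s.2)
    (hb : b ∈ fractional s.2) (α β : ℝ)
    (hx : α * I.tightRate s a + β * I.tightRate s b = 0) (hy : α + β = 0 ∨ ∑ i, s.2 i < I.T) :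
    α = 0 := by
  have := hs.perturb_eq_zero (Pi.single a α + Pi.single b β) (fun i hi => ?_) ?_ ?_
  · simpa [hab] using congrFun this a
  · by_contra hn
    have h1 : i ≠ a := fun e => hn (e ▸ ha)
    have h2 : i ≠ b := fun e => hn (e ▸ hb)
    simp [h1, h2] at hi
  · simpa [Pi.single_apply, add_mul, Finset.sum_add_distrib] using hx
  · simpa [Pi.single_apply, Finset.sum_add_distrib] using hy

theorem IsPtkBasic.tightRate_ne {I : SeqInstance} {s : (Fin I.n → ℝ) × (Fin I.n → ℝ)}
    (hs : I.IsPtkBasic s) {a b : Fin I.n} (hab : a ≠ b) (ha : a ∈ fractional s.2)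
    (hb : b ∈ fractional s.2) : I.tightRate s a ≠ I.tightRate s b := fun h =>
  one_ne_zero (hs.perturb_pair hab ha hb 1 (-1) (by rw [h]; ring) (.inl (by norm_num)))

theorem IsPtkBasic.roundable {I : SeqInstance} {s : (Fin I.n → ℝ) × (Fin I.n → ℝ)}
    (hs : I.IsPtkBasic s) : Roundable s.2 := by
  refine ⟨?_, fun h2 => ?_⟩
  · by_contra! h3
    obtain ⟨a, ha, b, hb, c, hc, hab, hac, hbc⟩ := Finset.two_lt_card.1 h3
    set e := I.tightRate s with he
    have := hs.perturb_eq_zero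
      -- Up to sign the cross product of (1, 1, 1) and the three rates, hence orthogonal to both; it
      -- is nonzero because the rates are distinct.
      (Pi.single a (e b - e c) + Pi.single b (e c - e a) + Pi.single c (e a - e b))
      (fun i hi => ?_) ?_ (.inl ?_)
    · have := congrFun this a
      simp [hab, hac] at this
      exact hs.tightRate_ne hbc hb hc (sub_eq_zero.1 this)
    · by_contra hn
      have h1 : i ≠ a := fun e => hn (e ▸ ha)
      have h2 : i ≠ b := fun e => hn (e ▸ hb)
      have h3 : i ≠ c := fun e => hn (e ▸ hc)
      simp [h1, h2, h3] at hi
    · simp only [Pi.add_apply, Pi.single_apply, add_mul, Finset.sum_add_distrib, ite_mul, zero_mul,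
        Finset.sum_ite_eq', Finset.mem_univ, if_true, ← he]
      ring
    · simp only [Pi.add_apply, Pi.single_apply, Finset.sum_add_distrib, Finset.sum_ite_eq',
        Finset.mem_univ, if_true]
      ring
  · obtain ⟨a, b, hab, hf⟩ := Finset.card_eq_two.1 h2
    have ha : a ∈ fractional s.2 := by simp [hf]
    have hb : b ∈ fractional s.2 := by simp [hf]
    have hT : ∑ i, s.2 i = I.T := by
      refine le_antisymm hs.1.2.1 (not_lt.1 fun hlt => ?_)
      -- With offers to spare only ∑ x must be preserved, and the perturbation (e_b, -e_a) does so.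
      -- Thus both rates would be 0, though they are distinct.
      have h1 := hs.perturb_pair hab ha hb (I.tightRate s b) (-I.tightRate s a) (by ring) (.inr hlt)
      have h2 := hs.perturb_pair hab.symm hb ha (I.tightRate s a) (-I.tightRate s b) (by ring)
        (.inr hlt)
      exact hs.tightRate_ne hab ha hb (h2.trans h1.symm)
    have hsum := sum_mul_eq_sum_one_add_sum_fractional hs.1.2.2.2.2 fun _ => 1
    simp only [mul_one, Finset.sum_const, nsmul_eq_mul] at hsum
    rw [hT] at hsum
    set m := (Finset.univ.filter fun i => s.2 i = 1).card
    obtain ⟨ha0, ha1⟩ := (Finset.mem_filter.1 ha).2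
    obtain ⟨hb0, hb1⟩ := (Finset.mem_filter.1 hb).2
    have hpair : ∑ i ∈ fractional s.2, s.2 i = s.2 a + s.2 b := by rw [hf, Finset.sum_pair hab]
    -- The two components add up to `T - m`, an integer strictly between 0 and 2.
    have hlo : m < I.T := by
      have : (m : ℝ) < I.T := by linarith
      exact_mod_cast this
    have hhi : I.T < m + 2 := by
      have : (I.T : ℝ) < (m + 2 : ℕ) := by push_cast; linarith
      exact_mod_cast this
    have : (I.T : ℝ) = m + 1 := by exact_mod_cast (by omega : I.T = m + 1)
    linarith

end SeqInstance

theorem corollary1 (I : SeqInstance) :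
    (∃ s, I.IsPtkBasic s ∧ I.IsPtkOptimal s ∧ I.IsTight s) ∧
    (∀ s, I.IsPtkBasic s → Roundable s.2) ∧
    ∀ s, I.IsPtkOptimal s → I.IsTight s → Roundable s.2 →
      ∀ σ : Equiv.Perm (Fin I.n), Antitone (fun a => I.value s (σ a)) →
        I.IsAdmissible (I.alg s σ) ∧
        (1 - Real.exp (-(I.k : ℝ)) * (I.k : ℝ) ^ I.k / (I.k ! : ℝ)) * I.LPseq
          ≤ I.expectedReward (I.alg s σ) :=
  ⟨I.exists_isPtkBasic_isPtkOptimal_isTight, fun _ hs => hs.roundable,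
    fun _ hs ht hr σ hσ => ⟨I.isAdmissible_alg ht hr σ, I.le_expectedReward_alg hs ht hr σ hσ⟩⟩
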